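/- Let $G$ be a Polish Lévy group, i.e. a Polish group which has compact subgroups $K_1\subset K_2\subset\cdots$ with dense union and a right-invariant compatible metric $d$ such that, with $m_n$ the normalized Haar measure of $K_n$, $(K_n,d,m_n)_n$ is a Lévy family: whenever $A_n\subset K_n$ are Borel sets with $\liminf_n m_n(A_n)>0$, then $\lim_n m_n(\{x\in K_n: d(x,a)<\varepsilon\text{ for some }a\in A_n\})=1$ for every $\varepsilon>0$. Let $(X,\mathcal X,\mu)$ be a standard Borel space with a probability measure, and let $G$ act on it by a boolean action, i.e. by a continuous homomorphism from $G$ to the group of measure preserving automorphisms of the measure algebra of $(X,\mathcal X,\mu)$ (measurable sets modulo null sets), where this group has the group topology generated at the identity by the sets $N(A,\varepsilon)=\{T:\mu(A\triangle TA)<\varepsilon\}$, with $A$ in the measure algebra and $\varepsilon>0$. If the action is ergodic (the only $G$-invariant elements of the measure algebra are $\emptyset$ and $X$), then it is whirly: for all $A,B$ of positive measure, every neighborhood of the identity of $G$ contains some $g$ with $\mu(A\cap gB)>0$. -/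

import Mathlib

open MeasureTheory Filter Topology
open scoped ENNReal symmDiff

/-- Equality modulo null sets, on the measurable subsets of `X`. -/
def aeEqSetoid {X : Type*} [MeasurableSpace X] (μ : Measure X) :
    Setoid {s : Set X // MeasurableSet s} where
  r s t := (s : Set X) =ᵐ[μ] (t : Set X)
  iseqv := ⟨fun _ => EventuallyEq.rfl, fun h => h.symm, fun h h' => h.trans h'⟩

/-- The measure algebra of `(X, μ)`: the measurable sets modulo null sets. -/
def MeasureAlgebra {X : Type*} [MeasurableSpace X] (μ : Measure X) : Type _ :=
  Quotient (aeEqSetoid μ)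

namespace MeasureAlgebra

variable {X : Type*} [MeasurableSpace X] {μ : Measure X}

/-- The class of a measurable set in the measure algebra. -/
def mk (μ : Measure X) (s : {s : Set X // MeasurableSet s}) : MeasureAlgebra μ :=
  Quotient.mk (aeEqSetoid μ) s

/-- The order is inclusion modulo null sets, and the operations are those of sets. -/
noncomputable instance instBooleanAlgebra : BooleanAlgebra (MeasureAlgebra μ) where
  le := Quotient.lift₂ (fun s t => (s : Set X) ≤ᵐ[μ] (t : Set X)) (by
    intro a b c d (h : (a : Set X) =ᵐ[μ] (c : Set X)) (h' : (b : Set X) =ᵐ[μ] (d : Set X))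
    exact propext ⟨fun k => (h.symm.le.trans k).trans h'.le,
      fun k => (h.le.trans k).trans h'.symm.le⟩)
  le_refl := by
    rintro ⟨a⟩
    exact EventuallyLE.rfl
  le_trans := by
    rintro ⟨a⟩ ⟨b⟩ ⟨c⟩ h h'
    exact EventuallyLE.trans h h'
  le_antisymm := by
    rintro ⟨a⟩ ⟨b⟩ h h'
    exact Quotient.sound (s := aeEqSetoid μ) (EventuallyLE.antisymm h h')
  sup := Quotient.map₂ (fun s t => ⟨(s : Set X) ∪ t, s.2.union t.2⟩)
    (fun _ _ h _ _ h' => EventuallyEq.union h h')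
  le_sup_left := by
    rintro ⟨a⟩ ⟨b⟩
    exact Eventually.of_forall fun _ => Or.inl
  le_sup_right := by
    rintro ⟨a⟩ ⟨b⟩
    exact Eventually.of_forall fun _ => Or.inr
  sup_le := by
    rintro ⟨a⟩ ⟨b⟩ ⟨c⟩ h h'
    exact (Eventually.and h h').mono fun _ hx => Or.rec hx.1 hx.2
  inf := Quotient.map₂ (fun s t => ⟨(s : Set X) ∩ t, s.2.inter t.2⟩)
    (fun _ _ h _ _ h' => EventuallyEq.inter h h')
  inf_le_left := by
    rintro ⟨a⟩ ⟨b⟩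
    exact Eventually.of_forall fun _ => And.left
  inf_le_right := by
    rintro ⟨a⟩ ⟨b⟩
    exact Eventually.of_forall fun _ => And.right
  le_inf := by
    rintro ⟨a⟩ ⟨b⟩ ⟨c⟩ h h'
    exact (Eventually.and h h').mono fun _ hx h0 => ⟨hx.1 h0, hx.2 h0⟩
  le_sup_inf := by
    rintro ⟨a⟩ ⟨b⟩ ⟨c⟩
    exact Eventually.of_forall fun _ h =>
      h.1.elim Or.inl fun hb => h.2.elim Or.inl fun hc => Or.inr ⟨hb, hc⟩
  compl := Quotient.map (fun s => ⟨(s : Set X)ᶜ, s.2.compl⟩)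
    (fun _ _ h => EventuallyEq.compl h)
  top := mk μ ⟨Set.univ, MeasurableSet.univ⟩
  bot := mk μ ⟨∅, MeasurableSet.empty⟩
  inf_compl_le_bot := by
    rintro ⟨a⟩
    exact Eventually.of_forall fun _ h => h.2 h.1
  top_le_sup_compl := by
    rintro ⟨a⟩
    exact Eventually.of_forall fun _ _ => Classical.em _
  le_top := by
    rintro ⟨a⟩
    exact Eventually.of_forall fun _ _ => trivial
  bot_le := by
    rintro ⟨a⟩
    exact Eventually.of_forall fun _ h => h.elim

/-- The measure of an element of the measure algebra. -/
noncomputable def meas (a : MeasureAlgebra μ) : ℝ≥0∞ :=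
  Quotient.lift (fun s : {s : Set X // MeasurableSet s} => μ (s : Set X))
    (fun _ _ h => measure_congr h) a

/-- The measure preserving automorphisms of the measure algebra. An order automorphism of a
Boolean algebra is the same thing as a Boolean algebra automorphism. -/
def autSubgroup (μ : Measure X) : Subgroup (MeasureAlgebra μ ≃o MeasureAlgebra μ) where
  carrier := {T | ∀ a, (T a).meas = a.meas}
  mul_mem' := by
    intro S T hS hT a
    exact (hS (T a)).trans (hT a)
  one_mem' := fun _ => rfl
  inv_mem' := by
    intro T hT a
    have h := hT (T⁻¹ a)
    rw [show T (T⁻¹ a) = a from T.apply_symm_apply a] at h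
    exact h.symm

/-- The automorphism group of the measure algebra of `(X, μ)`. -/
abbrev Aut (μ : Measure X) : Type _ := ↥(autSubgroup μ)

/-- The topology on the automorphism group generated by the sets
`{T | μ(SA ∆ TA) < ε}`, the left translates `S · N(A, ε)` of the sets
`N(A, ε) = {T | μ(A ∆ TA) < ε}`. -/
instance instTopologicalSpaceAut : TopologicalSpace (Aut μ) :=
  TopologicalSpace.generateFrom
    {V | ∃ (S : Aut μ) (A : MeasureAlgebra μ) (ε : ℝ≥0∞), 0 < ε ∧
      V = {T : Aut μ | (S.1 A ∆ T.1 A).meas < ε}}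

end MeasureAlgebra

/-- A boolean action of `G` on `(X, μ)`: a continuous homomorphism from `G` to the automorphism
group of the measure algebra. -/
structure BooleanAction (G : Type*) [Group G] [TopologicalSpace G]
    {X : Type*} [MeasurableSpace X] (μ : Measure X) where
  toHom : G →* MeasureAlgebra.Aut μ
  continuous_toHom : Continuous toHom

namespace BooleanAction

variable {G : Type*} [Group G] [TopologicalSpace G] {X : Type*} [MeasurableSpace X]
  {μ : Measure X}

/-- The element `gA` of the measure algebra. -/
noncomputable def act (φ : BooleanAction G μ) (g : G) (A : MeasureAlgebra μ) : MeasureAlgebra μ :=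
  (φ.toHom g).1 A

/-- Ergodicity: the only invariant elements of the measure algebra are the trivial ones. -/
def IsErgodic (φ : BooleanAction G μ) : Prop :=
  ∀ A : MeasureAlgebra μ, (∀ g : G, φ.act g A = A) → A = ⊥ ∨ A = ⊤

/-- The action is whirly if for all `A`, `B` of positive measure every neighborhood of the
identity contains some `g` with `μ(A ∩ gB) > 0`. -/
def IsWhirly (φ : BooleanAction G μ) : Prop :=
  ∀ A B : MeasureAlgebra μ, 0 < A.meas → 0 < B.meas →
    ∀ U ∈ 𝓝 (1 : G), ∃ g ∈ U, 0 < (A ⊓ φ.act g B).meas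

end BooleanAction

/-- A sequence of metric spaces `(X n, d n)` with measures `μ n` is a Lévy family if whenever
`liminf μ n (A n) > 0`, for every `ε > 0` the measures of the `ε`-neighborhoods of the `A n`
tend to `1`. -/
def IsLevyFamily (X : ℕ → Type*) (d : ∀ n, MetricSpace (X n)) [∀ n, MeasurableSpace (X n)]
    (μ : ∀ n, Measure (X n)) : Prop :=
  ∀ A : ∀ n, Set (X n), (∀ n, MeasurableSet (A n)) →
    0 < liminf (fun n => μ n (A n)) atTop →
      ∀ ε : ℝ, 0 < ε →
        Tendsto (fun n => μ n {x | ∃ a ∈ A n, (d n).dist x a < ε}) atTop (𝓝 1)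

/-- `G` is a Lévy group if there is an increasing sequence of compact subgroups `K n` with dense
union which, with their normalized Haar measures `m n` and the restrictions of some
right-invariant compatible metric `d` on `G`, form a Lévy family. -/
def IsLevyGroup (G : Type*) [Group G] [t : TopologicalSpace G] [MeasurableSpace G] : Prop :=
  ∃ (K : ℕ → Subgroup G) (d : MetricSpace G) (m : ∀ n, Measure (K n)),
    (∀ n, K n ≤ K (n + 1)) ∧
    (∀ n, @IsCompact G t (K n : Set G)) ∧
    @Dense G t (⋃ n, (K n : Set G)) ∧
    d.toUniformSpace.toTopologicalSpace = t ∧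
    (∀ a b c : G, d.dist (a * c) (b * c) = d.dist a b) ∧
    (∀ n, @Measure.IsHaarMeasure (K n) _ (@instTopologicalSpaceSubtype G (· ∈ K n) t) _ (m n)) ∧
    (∀ n, IsProbabilityMeasure (m n)) ∧
    IsLevyFamily (fun n => K n) (fun n => @Subtype.metricSpace G (· ∈ K n) d) m

/-! Suppose `A` misses `gB` for every `g` within `ε` of the identity, and average μ(a⁻¹A ∩ g⁻¹B)
over `a`, `g` in `K n`; this is `overlap`. If `G` acted on points, Fubini would turn the average
into ∫ m{a : ax ∈ A} · m{g : gx ∈ B} dμ(x). By right invariance of the metric the two sets would be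
`ε` apart, so the Lévy property makes the product small uniformly in `x`
(`IsLevyFamily.eventually_mul_le`). A boolean action has no points to move, so
`overlap_le_of_separated` first approximates the translates by countably many with fixed
representatives, at the cost of a smaller separation and a small error.

On the other hand, for fixed `B` the elements whose overlap with `B` tends to zero form a closed
ideal, invariant under each `K n` by Haar invariance and hence under `G` by density. Its greatest
element is invariant, so ergodicity makes it `⊥` or `⊤`. The overlap of `⊤` is constantly μ(B) > 0,
so it is `⊥` and `A` is null (`eq_bot_of_tendsto_overlap`). -/

namespace MeasureAlgebra

variable {X : Type*} [MeasurableSpace X] {μ : Measure X}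

/-! ### The measure algebra as a metric space -/

theorem exists_mk_eq (a : MeasureAlgebra μ) : ∃ s : {s : Set X // MeasurableSet s}, mk μ s = a :=
  Quotient.exists_rep a

theorem meas_mk (s : {s : Set X // MeasurableSet s}) : (mk μ s).meas = μ (s : Set X) := rfl

theorem mk_sup_mk (s t : {s : Set X // MeasurableSet s}) :
    mk μ s ⊔ mk μ t = mk μ ⟨(s : Set X) ∪ t, s.2.union t.2⟩ := rfl

theorem meas_mono {a b : MeasureAlgebra μ} (h : a ≤ b) : a.meas ≤ b.meas := by
  obtain ⟨s, rfl⟩ := exists_mk_eq a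
  obtain ⟨t, rfl⟩ := exists_mk_eq b
  exact measure_mono_ae h

theorem meas_sup_le (a b : MeasureAlgebra μ) : (a ⊔ b).meas ≤ a.meas + b.meas := by
  obtain ⟨s, rfl⟩ := exists_mk_eq a
  obtain ⟨t, rfl⟩ := exists_mk_eq b
  exact measure_union_le _ _

theorem meas_eq_zero {a : MeasureAlgebra μ} : a.meas = 0 ↔ a = ⊥ := by
  obtain ⟨s, rfl⟩ := exists_mk_eq a
  rw [meas_mk, ← ae_eq_empty]
  exact ⟨fun h => Quotient.sound (s := aeEqSetoid μ) h,
    fun h => Quotient.exact (s := aeEqSetoid μ) h⟩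

theorem le_of_meas_sup_le [IsFiniteMeasure μ] {a b : MeasureAlgebra μ}
    (h : (a ⊔ b).meas ≤ a.meas) : b ≤ a := by
  obtain ⟨s, rfl⟩ := exists_mk_eq a
  obtain ⟨t, rfl⟩ := exists_mk_eq b
  have h' := ae_eq_of_subset_of_measure_ge (μ := μ) (Set.subset_union_left (s := (s : Set X))
    (t := t)) h s.2.nullMeasurableSet (measure_ne_top _ _)
  exact (Set.subset_union_right.eventuallyLE).trans h'.symm.le

theorem meas_inf_le (a a' b b' : MeasureAlgebra μ) :
    (a ⊓ b).meas ≤ (a' ⊓ b').meas + ((a ∆ a').meas + (b ∆ b').meas) := by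
  have ha : a ≤ a ∆ a' ⊔ a' := le_symmDiff_sup_right a a'
  have hb : b ≤ b ∆ b' ⊔ b' := le_symmDiff_sup_right b b'
  have h : a ⊓ b ≤ a' ⊓ b' ⊔ (a ∆ a' ⊔ b ∆ b') := by
    refine (inf_le_inf ha hb).trans ?_
    rw [inf_sup_left, inf_sup_right, inf_sup_right]
    refine sup_le (le_sup_of_le_right (le_sup_of_le_right (sup_le inf_le_right inf_le_right))) ?_
    exact sup_le (le_sup_of_le_right (le_sup_of_le_left inf_le_left)) le_sup_left
  exact (meas_mono h).trans ((meas_sup_le _ _).trans (add_le_add_right (meas_sup_le _ _) _))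

/-- The pseudometric `μ(a ∆ b)` on the measure algebra. -/
noncomputable instance instPseudoEMetricSpace : PseudoEMetricSpace (MeasureAlgebra μ) where
  edist a b := (a ∆ b).meas
  edist_self a := by rw [symmDiff_self]; exact meas_eq_zero.2 rfl
  edist_comm a b := by rw [symmDiff_comm]
  edist_triangle a b c := (meas_mono (symmDiff_triangle a b c)).trans (meas_sup_le _ _)

theorem continuous_meas_inf :
    Continuous fun p : MeasureAlgebra μ × MeasureAlgebra μ => (p.1 ⊓ p.2).meas := by
  refine continuous_of_le_add_edist 2 (by simp) fun p q => ?_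
  refine (meas_inf_le p.1 q.1 p.2 q.2).trans (add_le_add_right ?_ _)
  rw [two_mul, Prod.edist_eq]
  exact add_le_add (le_max_left _ _) (le_max_right _ _)

theorem continuous_aut_apply (A : MeasureAlgebra μ) : Continuous fun T : Aut μ => T.1 A := by
  refine continuous_iff_continuousAt.2 fun S => EMetric.tendsto_nhds.2 fun ε hε => ?_
  have ho : IsOpen {T : Aut μ | (S.1 A ∆ T.1 A).meas < ε} :=
    TopologicalSpace.isOpen_generateFrom_of_mem ⟨S, A, ε, hε, rfl⟩
  filter_upwards [ho.mem_nhds (by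
    rwa [Set.mem_ofPred_eq, symmDiff_self, meas_eq_zero.2 rfl])] with T hT
  rwa [edist_comm]

/-- A family that contains `⊥`, is closed under finite suprema, and contains every element that
its members cover up to arbitrarily small measure, has a largest element. -/
theorem exists_isGreatest [IsFiniteMeasure μ] (N : Set (MeasureAlgebra μ)) (hbot : ⊥ ∈ N)
    (hsup : ∀ a ∈ N, ∀ b ∈ N, a ⊔ b ∈ N)
    (hlim : ∀ a, (∀ ε : ℝ≥0∞, 0 < ε → ∃ b ∈ N, (a \ b).meas < ε) → a ∈ N) :
    ∃ z, IsGreatest N z := by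
  obtain ⟨u, -, hu, huN⟩ := exists_seq_tendsto_sSup (S := meas '' N) ⟨_, ⊥, hbot, rfl⟩
    (OrderTop.bddAbove _)
  choose a haN ha using huN
  choose s hs using fun n => exists_mk_eq (a n)
  have hm : ∀ n, MeasurableSet (Set.accumulate (fun k => (s k : Set X)) n) := fun n =>
    MeasurableSet.biUnion (Set.to_countable _) fun k _ => (s k).2
  have hC : ∀ n, mk μ ⟨_, hm n⟩ ∈ N := by
    intro n
    induction n with
    | zero =>
      convert haN 0 using 1
      rw [← hs 0]
      congr 2
      simp
    | succ n ih =>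
      convert hsup _ ih _ (haN (n + 1)) using 1
      rw [← hs (n + 1), mk_sup_mk]
      congr 2
      exact Set.accumulate_succ _ n
  let Z : {s : Set X // MeasurableSet s} :=
    ⟨⋃ n, (s n : Set X), MeasurableSet.iUnion fun n => (s n).2⟩
  have hZ : mk μ Z ∈ N := by
    refine hlim _ fun ε hε => ?_
    have ht := tendsto_measure_iUnion_accumulate (μ := μ) (f := fun k => (s k : Set X))
    have h0 : Tendsto (fun n => μ ((Z : Set X) \ Set.accumulate (fun k => (s k : Set X)) n))
        atTop (𝓝 0) := by
      have h1 := ENNReal.Tendsto.sub (tendsto_const_nhds (x := μ Z) (f := atTop (α := ℕ))) ht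
        (Or.inl (measure_ne_top _ _))
      rw [tsub_self] at h1
      refine h1.congr fun n => (measure_sdiff ?_ (hm n).nullMeasurableSet (measure_ne_top _ _)).symm
      exact Set.accumulate_subset_iUnion n
    obtain ⟨n, hn⟩ := (h0.eventually (gt_mem_nhds hε)).exists
    exact ⟨_, hC n, hn⟩
  -- `Z` attains the supremum of the measures over `N`, so joining another member cannot increase
  -- its measure.
  refine ⟨mk μ Z, hZ, fun b hb => le_of_meas_sup_le ?_⟩
  refine (le_sSup (Set.mem_image_of_mem _ (hsup _ hZ _ hb))).trans ?_
  refine le_of_tendsto' hu fun n => ?_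
  rw [← ha n, ← hs n]
  exact measure_mono (Set.subset_iUnion (fun k => (s k : Set X)) n)

end MeasureAlgebra

/-! ### Algebra and continuity of boolean actions -/

namespace BooleanAction

variable {G : Type*} [Group G] [TopologicalSpace G] {X : Type*} [MeasurableSpace X]
  {μ : Measure X} (φ : BooleanAction G μ)

theorem act_one (A : MeasureAlgebra μ) : φ.act 1 A = A := by
  simp [act]

theorem act_mul (g h : G) (A : MeasureAlgebra μ) : φ.act (g * h) A = φ.act g (φ.act h A) := by
  simp [act]

theorem act_inf (g : G) (A B : MeasureAlgebra μ) :
    φ.act g (A ⊓ B) = φ.act g A ⊓ φ.act g B := map_inf (φ.toHom g).1 A B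

theorem act_sup (g : G) (A B : MeasureAlgebra μ) :
    φ.act g (A ⊔ B) = φ.act g A ⊔ φ.act g B := map_sup (φ.toHom g).1 A B

theorem act_mono (g : G) {A B : MeasureAlgebra μ} (h : A ≤ B) : φ.act g A ≤ φ.act g B :=
  (φ.toHom g).1.monotone h

theorem act_top (g : G) : φ.act g ⊤ = ⊤ := map_top (φ.toHom g).1

theorem meas_act (g : G) (A : MeasureAlgebra μ) : (φ.act g A).meas = A.meas :=
  (φ.toHom g).2 A

theorem continuous_act (A : MeasureAlgebra μ) : Continuous fun g => φ.act g A :=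
  (MeasureAlgebra.continuous_aut_apply A).comp φ.continuous_toHom

theorem meas_act_inv_inf_act_inv (a g : G) (A B : MeasureAlgebra μ) :
    (φ.act a⁻¹ A ⊓ φ.act g⁻¹ B).meas = (A ⊓ φ.act (a * g⁻¹) B).meas := by
  rw [← φ.meas_act a, act_inf, ← act_mul, ← act_mul, mul_inv_cancel, act_one]

theorem act_eq_of_forall_le {A : MeasureAlgebra μ} (h : ∀ g, φ.act g A ≤ A) (g : G) :
    φ.act g A = A := by
  refine (h g).antisymm ?_
  have := φ.act_mono g (h g⁻¹)
  rwa [← act_mul, mul_inv_cancel, act_one] at this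

end BooleanAction

/-! ### Concentration, discretization and Fubini -/

/-- In a Lévy family, sets at distance at least `ε` from each other cannot both be large. -/
theorem IsLevyFamily.eventually_mul_le {X : ℕ → Type*} {d : ∀ n, MetricSpace (X n)}
    [∀ n, MeasurableSpace (X n)] {μ : ∀ n, Measure (X n)} [∀ n, IsProbabilityMeasure (μ n)]
    (h : IsLevyFamily X d μ) {ε : ℝ} (hε : 0 < ε) {c : ℝ≥0∞} (hc : 0 < c) :
    ∀ᶠ n in atTop, ∀ S T : Set (X n), MeasurableSet S → MeasurableSet T →
      (∀ a ∈ S, ∀ b ∈ T, ε ≤ (d n).dist a b) → μ n S * μ n T ≤ c := by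
  classical
  by_contra hcon
  let P : ∀ n, Set (X n) → Prop := fun n S => MeasurableSet S ∧ ∃ T, MeasurableSet T ∧
    (∀ a ∈ S, ∀ b ∈ T, ε ≤ (d n).dist a b) ∧ c < μ n S * μ n T
  have hfreq : ∃ᶠ n in atTop, ∃ S, P n S := by
    refine (not_eventually.1 hcon).mono fun n hn => ?_
    push Not at hn
    obtain ⟨S, T, hS, hT, hST, hlt⟩ := hn
    exact ⟨S, hS, T, hT, hST, hlt⟩
  -- The default `univ` keeps the measures at least `min c 1` at indices without a bad pair, so the
  -- liminf is positive.
  let A : ∀ n, Set (X n) := fun n => if hn : ∃ S, P n S then hn.choose else Set.univ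
  have hPA : ∀ n, (∃ S, P n S) → P n (A n) := fun n hn => by
    simp only [A, dif_pos hn]
    exact hn.choose_spec
  have hAm : ∀ n, MeasurableSet (A n) := fun n => by
    by_cases hn : ∃ S, P n S
    · exact (hPA n hn).1
    · simp only [A, dif_neg hn, MeasurableSet.univ]
  have hA : ∀ n, min c 1 ≤ μ n (A n) := fun n => by
    by_cases hn : ∃ S, P n S
    · obtain ⟨-, T, -, -, hlt⟩ := hPA n hn
      exact (min_le_left _ _).trans (hlt.le.trans (mul_le_of_le_one_right' prob_le_one))
    · simp only [A, dif_neg hn, measure_univ, min_le_right]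
  have hmin : 0 < min c 1 := lt_min hc one_pos
  have hlim := h A hAm
    (hmin.trans_le (le_liminf_of_le (by isBoundedDefault) (Eventually.of_forall hA))) ε hε
  have hev := hlim.eventually
    (lt_mem_nhds (ENNReal.sub_lt_self ENNReal.one_ne_top one_ne_zero hmin.ne'))
  obtain ⟨n, hn, hlt⟩ := (hfreq.and_eventually hev).exists
  obtain ⟨-, T, hT, hsep, hcT⟩ := hPA n hn
  have hTc : min c 1 ≤ μ n T :=
    (min_le_left _ _).trans (hcT.le.trans (mul_le_of_le_one_left' prob_le_one))
  have hdisj : Disjoint {x | ∃ a ∈ A n, (d n).dist x a < ε} T := by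
    refine Set.disjoint_left.2 ?_
    rintro x ⟨a, ha, hxa⟩ hx
    have h1 := hsep a ha x hx
    rw [(d n).dist_comm] at h1
    exact hxa.not_ge h1
  have h1 := (measure_union hdisj hT).symm.trans_le (prob_le_one (μ := μ n))
  have h2 : (1 : ℝ≥0∞) < 1 := calc
    (1 : ℝ≥0∞) = 1 - min c 1 + min c 1 := (tsub_add_cancel_of_le (min_le_right _ _)).symm
    _ < μ n {x | ∃ a ∈ A n, (d n).dist x a < ε} + min c 1 :=
      ENNReal.add_lt_add_right (ne_top_of_le_ne_top ENNReal.one_ne_top (min_le_right _ _)) hlt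
    _ ≤ 1 := (add_le_add_right hTc _).trans h1
  exact lt_irrefl _ h2

/-- A countable measurable discretization of a separable space, as fine as a given reflexive
relation with open sections. -/
theorem exists_measurable_discretization {K : Type*} [TopologicalSpace K]
    [TopologicalSpace.SeparableSpace K] [Nonempty K] [MeasurableSpace K] [OpensMeasurableSpace K]
    (W : K → K → Prop) (hleft : ∀ p, IsOpen {a | W a p}) (hright : ∀ a, IsOpen {p | W a p})
    (hrefl : ∀ a, W a a) :
    ∃ (e : ℕ → K) (N : K → ℕ), Measurable N ∧ ∀ a, W a (e (N a)) := by
  classical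
  let e := TopologicalSpace.denseSeq K
  have h : ∀ a, ∃ n, W a (e n) := fun a => by
    obtain ⟨-, hp, n, rfl⟩ := (TopologicalSpace.denseRange_denseSeq K).inter_open_nonempty _
      (hright a) ⟨a, hrefl a⟩
    exact ⟨n, hp⟩
  exact ⟨e, fun a => Nat.find (h a), measurable_find h fun n => (hleft (e n)).measurableSet,
    fun a => Nat.find_spec (h a)⟩

/-- Fubini for the measures of the intersections of the sections of two sets. -/
theorem lintegral_lintegral_measure_inter {K X : Type*} [MeasurableSpace K] [MeasurableSpace X]
    (m : Measure K) [SFinite m] (μ : Measure X) [SFinite μ] {P Q : Set (K × X)}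
    (hP : MeasurableSet P) (hQ : MeasurableSet Q) :
    ∫⁻ a, ∫⁻ g, μ {x | (a, x) ∈ P ∧ (g, x) ∈ Q} ∂m ∂m =
      ∫⁻ x, m {a | (a, x) ∈ P} * m {g | (g, x) ∈ Q} ∂μ := by
  obtain ⟨p, hp0⟩ : ∃ p : K × X → ℝ≥0∞, p = P.indicator 1 := ⟨_, rfl⟩
  obtain ⟨q, hq0⟩ : ∃ q : K × X → ℝ≥0∞, q = Q.indicator 1 := ⟨_, rfl⟩
  have hp : Measurable p := hp0 ▸ measurable_one.indicator hP
  have hq : Measurable q := hq0 ▸ measurable_one.indicator hQ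
  have hpx : ∀ x, ∫⁻ a, p (a, x) ∂m = m {a | (a, x) ∈ P} := fun x =>
    hp0 ▸ lintegral_indicator_one (measurable_prodMk_right hP)
  have hqx : ∀ x, ∫⁻ g, q (g, x) ∂m = m {g | (g, x) ∈ Q} := fun x =>
    hq0 ▸ lintegral_indicator_one (measurable_prodMk_right hQ)
  have hpq : ∀ a g, μ {x | (a, x) ∈ P ∧ (g, x) ∈ Q} = ∫⁻ x, p (a, x) * q (g, x) ∂μ := by
    intro a g
    have hPQ : MeasurableSet {x | (a, x) ∈ P ∧ (g, x) ∈ Q} :=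
      (measurable_prodMk_left hP).inter (measurable_prodMk_left hQ)
    rw [← lintegral_indicator_one hPQ]
    refine lintegral_congr fun x => ?_
    by_cases h1 : (a, x) ∈ P <;> by_cases h2 : (g, x) ∈ Q <;> simp [hp0, hq0, h1, h2]
  calc ∫⁻ a, ∫⁻ g, μ {x | (a, x) ∈ P ∧ (g, x) ∈ Q} ∂m ∂m
      = ∫⁻ a, ∫⁻ x, p (a, x) * m {g | (g, x) ∈ Q} ∂μ ∂m := by
        refine lintegral_congr fun a => ?_
        simp_rw [hpq]
        have h1 : Measurable fun z : K × X => p (a, z.2) * q (z.1, z.2) :=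
          (hp.comp (measurable_prodMk_left.comp measurable_snd)).mul hq
        rw [lintegral_lintegral_swap h1.aemeasurable]
        refine lintegral_congr fun x => ?_
        have h2 : Measurable fun g => q (g, x) := hq.comp measurable_prodMk_right
        rw [lintegral_const_mul _ h2, hqx]
    _ = ∫⁻ x, m {a | (a, x) ∈ P} * m {g | (g, x) ∈ Q} ∂μ := by
        have h2 : Measurable fun z : K × X => p z * m {g | (g, z.2) ∈ Q} :=
          hp.mul ((measurable_measure_prodMk_right hQ).comp measurable_snd)
        rw [lintegral_lintegral_swap h2.aemeasurable]
        refine lintegral_congr fun x => ?_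
        have h3 : Measurable fun a => p (a, x) := hp.comp measurable_prodMk_right
        rw [lintegral_mul_const _ h3, hpx]

/-! ### Overlaps along the compact subgroups -/

namespace BooleanAction

variable {G : Type*} [Group G] {X : Type*} [MeasurableSpace X] {μ : Measure X}

theorem continuous_act_inv [TopologicalSpace G] [IsTopologicalGroup G]
    (φ : BooleanAction G μ) {K : Subgroup G} (A : MeasureAlgebra μ) :
    Continuous fun a : K => φ.act (a : G)⁻¹ A :=
  (φ.continuous_act A).comp continuous_subtype_val.inv

/-- The mean of `μ(a⁻¹A ∩ g⁻¹B)` over `a` and `g` in a subgroup `K` with a measure `m`. -/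
noncomputable def overlap [TopologicalSpace G] [MeasurableSpace G] (φ : BooleanAction G μ)
    {K : Subgroup G} (m : Measure K) (A B : MeasureAlgebra μ) : ℝ≥0∞ :=
  ∫⁻ a : K, ∫⁻ g : K, (φ.act (a : G)⁻¹ A ⊓ φ.act (g : G)⁻¹ B).meas ∂m ∂m

section Overlap

variable [TopologicalSpace G] [MeasurableSpace G] (φ : BooleanAction G μ)
  {K : Subgroup G} (m : Measure K)

theorem overlap_top [IsProbabilityMeasure m] (B : MeasureAlgebra μ) : φ.overlap m ⊤ B = B.meas := by
  simp [overlap, act_top, meas_act]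

theorem overlap_bot (B : MeasureAlgebra μ) : φ.overlap m ⊥ B = 0 := by
  have h : ∀ g, φ.act g ⊥ = ⊥ := fun g => map_bot (φ.toHom g).1
  simp [overlap, h, MeasureAlgebra.meas_eq_zero]

/-- This bound is uniform in `m`, which makes vanishing of overlaps in the limit a closed and
hereditary condition. -/
theorem overlap_le_add_meas_sdiff [IsProbabilityMeasure m] (A A' B : MeasureAlgebra μ) :
    φ.overlap m A B ≤ φ.overlap m A' B + (A \ A').meas := by
  calc φ.overlap m A B
      ≤ ∫⁻ a : K, (∫⁻ g : K, (φ.act (a : G)⁻¹ A' ⊓ φ.act (g : G)⁻¹ B).meas ∂m)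
          + (A \ A').meas ∂m := by
        refine lintegral_mono fun a => ?_
        calc _ ≤ ∫⁻ g : K, (φ.act (a : G)⁻¹ A' ⊓ φ.act (g : G)⁻¹ B).meas
                + (A \ A').meas ∂m := by
              refine lintegral_mono fun g => ?_
              rw [← φ.meas_act (a : G)⁻¹ (A \ A')]
              refine (MeasureAlgebra.meas_mono ?_).trans (MeasureAlgebra.meas_sup_le _ _)
              have h : A ≤ A' ⊔ A \ A' := le_sup_sdiff
              refine (inf_le_inf_right _ (φ.act_mono (a : G)⁻¹ h)).trans ?_
              rw [act_sup, inf_sup_right]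
              exact sup_le_sup_left inf_le_left _
          _ = _ := by simp [lintegral_add_right]
    _ = _ := by simp [lintegral_add_right, overlap]

/-- Substitute `h⁻¹a` for `a`: (h⁻¹a)⁻¹A = a⁻¹(hA). -/
theorem overlap_act [MeasurableMul K] [m.IsMulLeftInvariant] {h : G} (hh : h ∈ K)
    (A B : MeasureAlgebra μ) : φ.overlap m (φ.act h A) B = φ.overlap m A B := by
  unfold overlap
  rw [← lintegral_mul_left_eq_self (μ := m) (fun a : K => ∫⁻ g : K,
    (φ.act (a : G)⁻¹ A ⊓ φ.act (g : G)⁻¹ B).meas ∂m) ⟨h, hh⟩⁻¹]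
  simp [act_mul]

theorem measurable_meas_act_inv_inf [IsTopologicalGroup G] [SecondCountableTopology G]
    [BorelSpace G] (A B : MeasureAlgebra μ) :
    Measurable (Function.uncurry fun a g : K =>
      (φ.act (a : G)⁻¹ A ⊓ φ.act (g : G)⁻¹ B).meas) := by
  have : SecondCountableTopology K := inferInstanceAs (SecondCountableTopology (K : Set G))
  have h : Continuous fun p : K × K => (φ.act (p.1 : G)⁻¹ A, φ.act (p.2 : G)⁻¹ B) :=
    ((φ.continuous_act_inv A).comp continuous_fst).prodMk
      ((φ.continuous_act_inv B).comp continuous_snd)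
  exact (MeasureAlgebra.continuous_meas_inf.comp h).measurable

theorem overlap_sup_le [IsProbabilityMeasure m] [IsTopologicalGroup G]
    [SecondCountableTopology G] [BorelSpace G] (A A' B : MeasureAlgebra μ) :
    φ.overlap m (A ⊔ A') B ≤ φ.overlap m A B + φ.overlap m A' B := by
  have hmeas := φ.measurable_meas_act_inv_inf (K := K) A B
  have hint : Measurable fun a : K =>
      ∫⁻ g : K, (φ.act (a : G)⁻¹ A ⊓ φ.act (g : G)⁻¹ B).meas ∂m := hmeas.lintegral_prod_right
  unfold overlap
  rw [← lintegral_add_left hint]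
  refine lintegral_mono fun a => ?_
  have hsec : Measurable fun g : K => (φ.act (a : G)⁻¹ A ⊓ φ.act (g : G)⁻¹ B).meas :=
    hmeas.of_uncurry_left
  simp only
  rw [← lintegral_add_left hsec]
  refine lintegral_mono fun g => ?_
  simp only
  rw [act_sup, inf_sup_right]
  exact MeasureAlgebra.meas_sup_le _ _

end Overlap

/-- If `A` and `gB` are disjoint for all `g` in a ball around `1`, then the overlap of `A` and `B`
is controlled by the measures of pairs of sets that are far apart in `K`. -/
theorem overlap_le_of_separated [MetricSpace G] [IsTopologicalGroup G]
    [SecondCountableTopology G] [MeasurableSpace G] [BorelSpace G] [IsFiniteMeasure μ]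
    (hd : ∀ a b c : G, dist (a * c) (b * c) = dist a b)
    (φ : BooleanAction G μ) {K : Subgroup G} (m : Measure K) [IsProbabilityMeasure m]
    {A B : MeasureAlgebra μ} {ε : ℝ} (hε : 0 < ε)
    (hAB : ∀ g : G, dist g 1 < ε → (A ⊓ φ.act g B).meas = 0) {c : ℝ≥0∞}
    (hc : ∀ S T : Set K, MeasurableSet S → MeasurableSet T →
      (∀ a ∈ S, ∀ b ∈ T, ε / 2 ≤ dist a b) → m S * m T ≤ c) {η : ℝ≥0∞} (hη : 0 < η) :
    φ.overlap m A B ≤ c * μ Set.univ + η := by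
  have hη2 : 0 < η / 2 := ENNReal.half_pos hη.ne'
  let f : MeasureAlgebra μ → K → MeasureAlgebra μ := fun A a => φ.act (a : G)⁻¹ A
  have hf : ∀ A, Continuous (f A) := fun A => φ.continuous_act_inv A
  -- Two errors of `ε / 4` reduce separation `ε` to `ε / 2`; two errors of `η / 2` in the translates
  -- add up to `η`.
  let W : K → K → Prop := fun a p => dist a p < ε / 4 ∧ edist (f A a) (f A p) < η / 2 ∧
    edist (f B a) (f B p) < η / 2
  have : SecondCountableTopology K :=
    inferInstanceAs (SecondCountableTopology (K : Set G))
  obtain ⟨e, N, hN, hW⟩ := exists_measurable_discretization W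
    (fun p => (isOpen_lt (continuous_id.dist continuous_const) continuous_const).inter
      ((isOpen_lt ((hf A).edist continuous_const) continuous_const).inter
        (isOpen_lt ((hf B).edist continuous_const) continuous_const)))
    (fun a => (isOpen_lt (continuous_const.dist continuous_id) continuous_const).inter
      ((isOpen_lt (continuous_const.edist (hf A)) continuous_const).inter
        (isOpen_lt (continuous_const.edist (hf B)) continuous_const)))
    (fun a => ⟨by simpa using hε, by simpa using hη2, by simpa using hη2⟩)
  choose R hR using fun i => MeasureAlgebra.exists_mk_eq (f A (e i))
  choose Q hQ using fun i => MeasureAlgebra.exists_mk_eq (f B (e i))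
  have hmeas : ∀ R : ℕ → {s : Set X // MeasurableSet s},
      MeasurableSet {p : K × X | p.2 ∈ (R (N p.1) : Set X)} := fun R => by
    have : {p : K × X | p.2 ∈ (R (N p.1) : Set X)} = ⋃ i, (N ⁻¹' {i}) ×ˢ (R i : Set X) := by
      ext p
      simp
    rw [this]
    exact MeasurableSet.iUnion fun i => (hN (measurableSet_singleton i)).prod (R i).2
  -- Countably many pairs of representatives allow a single exceptional null set. Right translation
  -- by `e j` identifies the distance from `e i * (e j)⁻¹` to `1` with that from `e i` to `e j`.
  have hnull : ∀ᵐ x ∂μ, ∀ i j, dist (e i) (e j) < ε → ¬ (x ∈ (R i : Set X) ∧ x ∈ (Q j : Set X)) := by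
    refine ae_all_iff.2 fun i => ae_all_iff.2 fun j => ?_
    by_cases hij : dist (e i) (e j) < ε
    · have h0 : μ ((R i : Set X) ∩ Q j) = 0 := by
        change (MeasureAlgebra.mk μ (R i) ⊓ MeasureAlgebra.mk μ (Q j)).meas = 0
        rw [hR, hQ, φ.meas_act_inv_inf_act_inv]
        refine hAB _ ?_
        rw [← hd _ _ (e j : G)]
        simpa [Subtype.dist_eq] using hij
      exact (measure_eq_zero_iff_ae_notMem.1 h0).mono fun x hx _ => hx
    · exact Eventually.of_forall fun x h => absurd h hij
  have hfub := lintegral_lintegral_measure_inter m μ (hmeas R) (hmeas Q)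
  have hle : ∫⁻ x, m {a | x ∈ (R (N a) : Set X)} * m {g | x ∈ (Q (N g) : Set X)} ∂μ
      ≤ c * μ Set.univ := by
    rw [← lintegral_const]
    refine lintegral_mono_ae (hnull.mono fun x hx => hc _ _ ?_ ?_ fun a ha g hg => ?_)
    · exact measurable_prodMk_right (hmeas R)
    · exact measurable_prodMk_right (hmeas Q)
    · have h1 : ε ≤ dist (e (N a)) (e (N g)) := not_lt.1 fun h => hx _ _ h ⟨ha, hg⟩
      have h2 := dist_triangle4 (e (N a)) a g (e (N g))
      have h3 := (hW a).1
      have h4 := (hW g).1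
      rw [dist_comm] at h3
      linarith
  calc φ.overlap m A B
      ≤ ∫⁻ a, (∫⁻ g, μ {x | x ∈ (R (N a) : Set X) ∧ x ∈ (Q (N g) : Set X)} ∂m) + η ∂m := by
        refine lintegral_mono fun a => ?_
        calc _ ≤ ∫⁻ g, μ {x | x ∈ (R (N a) : Set X) ∧ x ∈ (Q (N g) : Set X)} + η ∂m := by
              refine lintegral_mono fun g => ?_
              refine (MeasureAlgebra.meas_inf_le _ (f A (e (N a))) _ (f B (e (N g)))).trans ?_
              refine add_le_add ?_ ?_
              · rw [← hR, ← hQ]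
                exact le_rfl
              · rw [← ENNReal.add_halves η]
                exact add_le_add (hW a).2.1.le (hW g).2.2.le
          _ = _ := by simp [lintegral_add_right]
    _ = (∫⁻ x, m {a | x ∈ (R (N a) : Set X)} * m {g | x ∈ (Q (N g) : Set X)} ∂μ) + η := by
        rw [lintegral_add_right _ measurable_const]
        rw [lintegral_const, measure_univ, mul_one]
        exact congrArg (· + η) hfub
    _ ≤ _ := add_le_add_left hle _

/-- For an ergodic action, the overlaps of `A` and `B` along an increasing sequence of subgroups
with dense union do not tend to zero unless `A` or `B` is null. -/
theorem eq_bot_of_tendsto_overlap [TopologicalSpace G] [IsTopologicalGroup G]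
    [SecondCountableTopology G] [MeasurableSpace G] [BorelSpace G] [IsFiniteMeasure μ]
    {φ : BooleanAction G μ} (hφ : φ.IsErgodic) {K : ℕ → Subgroup G} (hK : Monotone K)
    (hdense : Dense (⋃ n, (K n : Set G))) (m : ∀ n, Measure (K n))
    [∀ n, IsProbabilityMeasure (m n)] [∀ n, (m n).IsMulLeftInvariant]
    {A B : MeasureAlgebra μ} (hB : B ≠ ⊥)
    (hA : Tendsto (fun n => φ.overlap (m n) A B) atTop (𝓝 0)) : A = ⊥ := by
  let I : Set (MeasureAlgebra μ) := {A | Tendsto (fun n => φ.overlap (m n) A B) atTop (𝓝 0)}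
  have hlim : ∀ a, (∀ ε : ℝ≥0∞, 0 < ε → ∃ b ∈ I, (a \ b).meas < ε) → a ∈ I := by
    refine fun a h => ENNReal.tendsto_nhds_zero.2 fun ε hε => ?_
    obtain ⟨b, hb, hab⟩ := h (ε / 2) (ENNReal.half_pos hε.ne')
    filter_upwards [ENNReal.tendsto_nhds_zero.1 hb (ε / 2) (ENNReal.half_pos hε.ne')] with n hn
    rw [← ENNReal.add_halves ε]
    exact (φ.overlap_le_add_meas_sdiff (m n) a b B).trans (add_le_add hn hab.le)
  have hact : ∀ g, ∀ a ∈ I, φ.act g a ∈ I := by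
    refine fun g a ha => hlim _ fun ε hε => ?_
    have hopen : IsOpen {h : G | edist (φ.act g a) (φ.act h a) < ε} :=
      isOpen_lt (continuous_const.edist (φ.continuous_act a)) continuous_const
    -- Approximate `g` by some `h` in `K k`: for `n ≥ k` the overlaps of `ha` and `a` agree, and
    -- closedness passes to `ga`.
    obtain ⟨h, hh, hhK⟩ := hdense.inter_open_nonempty _ hopen ⟨g, by simpa using hε⟩
    obtain ⟨k, hk⟩ := Set.mem_iUnion.1 hhK
    refine ⟨φ.act h a, ?_, (MeasureAlgebra.meas_mono le_sup_left).trans_lt hh⟩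
    refine Tendsto.congr' ?_ ha
    filter_upwards [eventually_ge_atTop k] with n hn
    exact (φ.overlap_act (m n) (hK hn hk) a B).symm
  obtain ⟨Z, hZ, hmax⟩ := MeasureAlgebra.exists_isGreatest I
    (by simp [I, overlap_bot])
    (fun a ha b hb => by
      refine tendsto_of_tendsto_of_tendsto_of_le_of_le tendsto_const_nhds
        (by simpa using ha.add hb) (fun n => zero_le) fun n => φ.overlap_sup_le (m n) a b B)
    hlim
  rcases hφ Z (φ.act_eq_of_forall_le fun g => hmax (hact g Z hZ)) with rfl | rfl
  · exact le_bot_iff.1 (hmax hA)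
  · refine absurd (tendsto_nhds_unique hZ ?_) (fun h => hB (MeasureAlgebra.meas_eq_zero.1 h.symm))
    simp [overlap_top]

end BooleanAction

theorem mainTheorem3 {G : Type*} [Group G] [TopologicalSpace G] [IsTopologicalGroup G]
    [PolishSpace G] [MeasurableSpace G] [BorelSpace G] (hG : IsLevyGroup G)
    {X : Type*} [MeasurableSpace X] [StandardBorelSpace X]
    (μ : Measure X) [IsProbabilityMeasure μ]
    (φ : BooleanAction G μ) (hφ : φ.IsErgodic) : φ.IsWhirly := by
  obtain ⟨K, d, m, hK, -, hdense, rfl, hd, hHaar, hm, hLevy⟩ := hG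
  intro A B hA hB U hU
  by_contra! hcon
  obtain ⟨ε, hε, hεU⟩ := Metric.mem_nhds_iff.1 hU
  have hAB : ∀ g : G, dist g 1 < ε → (A ⊓ φ.act g B).meas = 0 := fun g hg =>
    le_zero_iff.1 (hcon g (hεU hg))
  have hinv : ∀ n, (m n).IsMulLeftInvariant := fun n => (hHaar n).toIsMulLeftInvariant
  refine hA.ne' (MeasureAlgebra.meas_eq_zero.2 (BooleanAction.eq_bot_of_tendsto_overlap hφ
    (monotone_nat_of_le_succ hK) hdense m (B := B)
    (fun h => hB.ne' (MeasureAlgebra.meas_eq_zero.2 h)) ?_))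
  refine ENNReal.tendsto_nhds_zero.2 fun c hc => ?_
  -- One half bounds the product of separated sets, the other the discretization error.
  have hc2 : 0 < c / 2 := ENNReal.half_pos hc.ne'
  filter_upwards [hLevy.eventually_mul_le (half_pos hε) hc2] with n hn
  have h := φ.overlap_le_of_separated hd (m n) hε hAB hn hc2
  rwa [measure_univ, mul_one, ENNReal.add_halves] at h
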